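/- Let $d\ge 0$, let $\Omega\subseteq\mathbb{R}^d$ be convex, and let $f$ be a real-valued function that is $C^2$ on an open neighbourhood of $\Omega$. For $x\in\Omega$ put $\ell(x)=\max_{1\le j\le d}\max(\lambda_j(x),0)$, where $\lambda_1(x),\dots,\lambda_d(x)$ are the eigenvalues of the Hessian $\nabla^2 f(x)$, and assume that $L_+=\sup_{x\in\Omega}\ell(x)$ is finite. Let $\alpha\in\mathbb{R}$ satisfy $\alpha L_+\in(0,1)$, put $g(x)=x-\alpha\nabla f(x)$, and assume that $\Omega$ is forward invariant, i.e. $g(\Omega)\subseteq\Omega$. Call a point $p$ a strict saddle of $f$ if $f$ is $C^2$ near $p$, $\nabla f(p)=0$, and $\nabla^2 f(p)$ has at least one negative eigenvalue. Then the set of all $x^0\in\Omega$ such that the gradient descent iterates $g^n(x^0)$ converge, as $n\to\infty$, to some strict saddle of $f$ has Lebesgue measure zero. -/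

import Mathlib

/-- The Hessian of `f` at `x`, as the derivative of the gradient field. -/
noncomputable def hessian {d : ℕ} (f : EuclideanSpace ℝ (Fin d) → ℝ)
    (x : EuclideanSpace ℝ (Fin d)) :
    EuclideanSpace ℝ (Fin d) →L[ℝ] EuclideanSpace ℝ (Fin d) :=
  fderiv ℝ (gradient f) x

/-- `μ` is an eigenvalue of the Hessian of `f` at `x`. -/
def IsHessianEigenvalue {d : ℕ} (f : EuclideanSpace ℝ (Fin d) → ℝ)
    (x : EuclideanSpace ℝ (Fin d)) (μ : ℝ) : Prop :=
  Module.End.HasEigenvalue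
    (hessian f x : EuclideanSpace ℝ (Fin d) →ₗ[ℝ] EuclideanSpace ℝ (Fin d)) μ

/-- The largest positive part `max_j max (λ_j(x), 0)` of the eigenvalues of the Hessian of `f`
at `x`. The set of eigenvalues is finite, so the supremum is a maximum
(it is `0` in dimension zero). -/
noncomputable def hessianPosPart {d : ℕ} (f : EuclideanSpace ℝ (Fin d) → ℝ)
    (x : EuclideanSpace ℝ (Fin d)) : ℝ :=
  sSup ((fun μ : ℝ => max μ 0) '' {μ : ℝ | IsHessianEigenvalue f x μ})

/-- A strict saddle point of `f`: a critical point, near which `f` is `C²`, where the Hessian has a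
negative eigenvalue. -/
def IsStrictSaddle {d : ℕ} (f : EuclideanSpace ℝ (Fin d) → ℝ)
    (x : EuclideanSpace ℝ (Fin d)) : Prop :=
  ContDiffAt ℝ 2 f x ∧ gradient f x = 0 ∧ ∃ μ : ℝ, μ < 0 ∧ IsHessianEigenvalue f x μ

/-- One step of gradient descent with step size `α`. -/
noncomputable def gradStep {d : ℕ} (f : EuclideanSpace ℝ (Fin d) → ℝ) (α : ℝ)
    (x : EuclideanSpace ℝ (Fin d)) : EuclideanSpace ℝ (Fin d) :=
  x - α • gradient f x

/-!
# Gradient descent almost never converges to a strict saddle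

Write `g = gradStep f α`. On the convex set `Ω` the Hessian of `f` is at most `L`, so the derivative
`1 - α ∇²f` of `g` is at least `c = 1 - α L > 0` as a quadratic form. Integrating along segments,
`g` is strongly monotone on `Ω` and hence has a `c⁻¹`-Lipschitz inverse there
(`mul_dist_le_dist_gradStep`). No lower bound on the Hessian is used, and `g` itself need not be
Lipschitz. Therefore preimages in `Ω` of null sets under the iterates of `g` are null, and by
Lindelöf it is enough that every strict saddle `p` in the closure of `Ω` has a neighbourhood `U`
such that the points whose whole orbit stays in `U` form a null set.

This local statement replaces the center-stable manifold theorem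
(`exists_nhds_hausdorffMeasure_eq_zero`). The derivative `A = 1 - α ∇²f(p)` is symmetric,
nonnegative, and has an eigenvalue `β > 1`. Pick `γ ∈ (1, β)` which is not an eigenvalue and put
`Q z = ⟪A z, z⟫ - γ ‖z‖²`. Then `Q (A z) ≥ γ² Q z + κ ‖z‖²` with `κ > 0`, and so
`Q (g x - g y) ≥ γ² Q (x - y)` for `x`, `y` near `p` (`exists_nhds_sq_mul_inner_sub_le`). If two
orbits stay near `p`, then `Q` of their difference is bounded, which forces `Q (x - y) ≤ 0`. Since
`Q` is positive on a `β`-eigenvector `v`, the points with orbit near `p` form a Lipschitz graph over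
a subset of the hyperplane `vᗮ`, and such a graph is null
(`hausdorffMeasure_eq_zero_of_inner_sub_nonpos`). Null sets are measured with the `d`-dimensional
Hausdorff measure, a multiple of Lebesgue measure that behaves well under Lipschitz maps between
different spaces.
-/

open MeasureTheory Module Filter Topology
open scoped NNReal ENNReal InnerProductSpace

/-! ### Hausdorff-null sets and maps with Lipschitz inverse -/

/-- A subset of a space on which some map has a Lipschitz inverse is Hausdorff-null as soon as its
image is. -/
theorem hausdorffMeasure_eq_zero_of_antilipschitzOn {X Y : Type*}
    [MetricSpace X] [MeasurableSpace X] [BorelSpace X]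
    [MetricSpace Y] [MeasurableSpace Y] [BorelSpace Y]
    {s : Set X} {h : X → Y} {K : ℝ≥0} {r : ℝ} (hr : 0 ≤ r)
    (hK : ∀ x ∈ s, ∀ y ∈ s, dist x y ≤ K * dist (h x) (h y))
    (h0 : μH[r] (h '' s) = 0) : μH[r] s = 0 := by
  have hA : AntilipschitzWith K (s.domRestrict h) :=
    AntilipschitzWith.of_le_mul_dist fun x y => hK x x.2 y y.2
  have h1 := hA.le_hausdorffMeasure_image hr Set.univ
  rw [Set.image_univ, Set.range_domRestrict, h0, mul_zero, nonpos_iff_eq_zero] at h1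
  have h2 := (isometry_subtype_coe (s := s)).hausdorffMeasure_image (Or.inl hr) Set.univ
  rwa [Set.image_univ, Subtype.range_coe, h1] at h2

/-! ### Orbits near an unstable fixed point -/

section Dynamics

variable {E : Type*} [NormedAddCommGroup E] [InnerProductSpace ℝ E]

/-- For symmetric `A ≥ 0` the form `Q z = ⟪A z, z⟫ - γ ‖z‖²` satisfies
`Q (A z) = γ² Q z + ⟪(A + γ) w, w⟫ ≥ γ² Q z + γ ‖w‖²` with `w = A z - γ z`; the equality is
`(A² - γ²)(A - γ) = (A - γ)(A + γ)(A - γ)`. -/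
theorem sq_mul_inner_sub_add_le {A : E →L[ℝ] E} (hA : (A : E →ₗ[ℝ] E).IsSymmetric)
    (hpos : ∀ z, 0 ≤ ⟪A z, z⟫_ℝ) (γ : ℝ) (z : E) :
    γ ^ 2 * (⟪A z, z⟫_ℝ - γ * ‖z‖ ^ 2) + γ * ‖A z - γ • z‖ ^ 2
      ≤ ⟪A (A z), A z⟫_ℝ - γ * ‖A z‖ ^ 2 := by
  have hA' : ∀ x y, ⟪A x, y⟫_ℝ = ⟪x, A y⟫_ℝ := fun x y => hA x y
  have h := hpos (A z - γ • z)
  have e1 : ⟪A (A z), z⟫_ℝ = ‖A z‖ ^ 2 := by rw [hA', real_inner_self_eq_norm_sq]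
  have e2 : ⟪z, A z⟫_ℝ = ⟪A z, z⟫_ℝ := real_inner_comm _ _
  simp only [map_sub, map_smul, inner_sub_left, inner_sub_right, real_inner_smul_left,
    real_inner_smul_right, e1, real_inner_self_eq_norm_sq] at h
  have e3 : ‖A z - γ • z‖ ^ 2 = ‖A z‖ ^ 2 - 2 * γ * ⟪A z, z⟫_ℝ + γ ^ 2 * ‖z‖ ^ 2 := by
    rw [norm_sub_sq_real, real_inner_smul_right, norm_smul, mul_pow, Real.norm_eq_abs, sq_abs]
    ring
  rw [e3]
  linarith

/-- Near a point where `g` has strict derivative `A`, the form `Q z = ⟪A z, z⟫ - γ ‖z‖²` of the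
difference of two points grows by the factor `γ²` under `g`. That `γ` is not an eigenvalue gives
the margin that absorbs the nonlinear error. -/
theorem exists_nhds_sq_mul_inner_sub_le [FiniteDimensional ℝ E] {g : E → E} {A : E →L[ℝ] E} {p : E}
    (hg : HasStrictFDerivAt g A p) (hA : (A : E →ₗ[ℝ] E).IsSymmetric)
    (hpos : ∀ z, 0 ≤ ⟪A z, z⟫_ℝ) {γ : ℝ} (hγ : 0 < γ)
    (hne : ¬ End.HasEigenvalue (A : E →ₗ[ℝ] E) γ) :
    ∃ U ∈ 𝓝 p, ∀ x ∈ U, ∀ y ∈ U,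
      γ ^ 2 * (⟪A (x - y), x - y⟫_ℝ - γ * ‖x - y‖ ^ 2)
        ≤ ⟪A (g x - g y), g x - g y⟫_ℝ - γ * ‖g x - g y‖ ^ 2 := by
  have hker : LinearMap.ker ((A : E →ₗ[ℝ] E) - γ • LinearMap.id) = ⊥ := by
    rw [End.hasEigenvalue_iff, not_not, End.eigenspace_def] at hne
    exact hne
  obtain ⟨K, hK0, hK⟩ := LinearMap.exists_antilipschitzWith _ hker
  have hK' : ∀ z, ‖z‖ ≤ K * ‖A z - γ • z‖ := fun z => by
    simpa [dist_eq_norm] using hK.le_mul_dist z 0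
  have hK0' : (0 : ℝ) < K := hK0
  set M : ℝ := 2 * ((‖A‖ + γ) * ‖A‖) + γ with hM
  have hM0 : 0 < M := by positivity
  -- `ε` makes the error `M ε ‖z‖²` at most the margin `γ ‖z‖² / K²`.
  set ε : ℝ := min 1 (γ / K ^ 2 / M) with hε
  have hε0 : 0 < ε := by positivity
  have hε1 : ε ≤ 1 := min_le_left _ _
  have hεM : M * ε ≤ γ / K ^ 2 := by
    have := min_le_right 1 (γ / K ^ 2 / M)
    rw [← hε, le_div_iff₀ hM0] at this
    linarith
  have hev := (hasStrictFDerivAt_iff_isLittleO.1 hg).def hε0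
  rw [nhds_prod_eq] at hev
  obtain ⟨U, hU, hUU⟩ := eventually_prod_self_iff'.1 hev
  refine ⟨U, hU, fun x hx y hy => ?_⟩
  have he : ‖g x - g y - A (x - y)‖ ≤ ε * ‖x - y‖ := hUU x hx y hy
  set z := x - y
  set e := g x - g y - A z with hedef
  have hgz : g x - g y = A z + e := by simp [hedef]
  rw [hgz]
  have hbase := sq_mul_inner_sub_add_le hA hpos γ z
  have hA' : ∀ x y, ⟪A x, y⟫_ℝ = ⟪x, A y⟫_ℝ := fun x y => hA x y
  have hexp : ⟪A (A z + e), A z + e⟫_ℝ - γ * ‖A z + e‖ ^ 2 =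
      (⟪A (A z), A z⟫_ℝ - γ * ‖A z‖ ^ 2) + 2 * ⟪A (A z) - γ • A z, e⟫_ℝ
        + (⟪A e, e⟫_ℝ - γ * ‖e‖ ^ 2) := by
    have h1 : ⟪A e, A z⟫_ℝ = ⟪A (A z), e⟫_ℝ := by rw [hA', real_inner_comm]
    rw [norm_add_sq_real, map_add, inner_add_left, inner_add_right, inner_add_right, h1,
      inner_sub_left, real_inner_smul_left]
    ring
  have hAz : ‖A z‖ ≤ ‖A‖ * ‖z‖ := A.le_opNorm z
  have hcross : ‖A (A z) - γ • A z‖ ≤ (‖A‖ + γ) * ‖A‖ * ‖z‖ := by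
    calc ‖A (A z) - γ • A z‖ ≤ ‖A (A z)‖ + ‖γ • A z‖ := norm_sub_le _ _
      _ ≤ ‖A‖ * ‖A z‖ + γ * ‖A z‖ := by
          rw [norm_smul, Real.norm_eq_abs, abs_of_pos hγ]
          gcongr
          exact A.le_opNorm _
      _ = (‖A‖ + γ) * ‖A z‖ := by ring
      _ ≤ (‖A‖ + γ) * (‖A‖ * ‖z‖) := by gcongr
      _ = _ := by ring
  have hin : -((‖A‖ + γ) * ‖A‖ * ‖z‖ * (ε * ‖z‖)) ≤ ⟪A (A z) - γ • A z, e⟫_ℝ := by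
    refine (neg_le_neg ?_).trans (neg_le_of_abs_le (abs_real_inner_le_norm _ _))
    gcongr
  have he2 : ‖e‖ ^ 2 ≤ ε * ‖z‖ ^ 2 := by
    calc ‖e‖ ^ 2 ≤ (ε * ‖z‖) ^ 2 := by gcongr
      _ = ε * (ε * ‖z‖ ^ 2) := by ring
      _ ≤ 1 * (ε * ‖z‖ ^ 2) := by gcongr
      _ = _ := one_mul _
  have he3 : γ * ‖e‖ ^ 2 ≤ γ * (ε * ‖z‖ ^ 2) := by gcongr
  have hmargin : γ / K ^ 2 * ‖z‖ ^ 2 ≤ γ * ‖A z - γ • z‖ ^ 2 := by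
    have h1 : ‖z‖ ^ 2 ≤ (K * ‖A z - γ • z‖) ^ 2 := by
      gcongr
      exact hK' z
    rw [div_mul_eq_mul_div, div_le_iff₀ (by positivity)]
    calc γ * ‖z‖ ^ 2 ≤ γ * (K * ‖A z - γ • z‖) ^ 2 := by gcongr
      _ = _ := by ring
  have hfin : M * ε * ‖z‖ ^ 2 ≤ γ / K ^ 2 * ‖z‖ ^ 2 := by gcongr
  have hMexp : M * ε * ‖z‖ ^ 2 =
      2 * ((‖A‖ + γ) * ‖A‖ * ‖z‖ * (ε * ‖z‖)) + γ * (ε * ‖z‖ ^ 2) := by rw [hM]; ring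
  rw [hexp]
  linarith [hpos e]

/-- Two orbits that stay near the fixed point cannot differ by a vector on which
`Q z = ⟪A z, z⟫ - γ ‖z‖²` is positive: otherwise `Q` of the difference would grow at least like
`γ ^ (2 n)`, while the difference stays bounded. -/
theorem exists_nhds_inner_sub_nonpos [FiniteDimensional ℝ E] {g : E → E} {A : E →L[ℝ] E} {p : E}
    (hg : HasStrictFDerivAt g A p) (hA : (A : E →ₗ[ℝ] E).IsSymmetric)
    (hpos : ∀ z, 0 ≤ ⟪A z, z⟫_ℝ) {γ : ℝ} (hγ : 1 < γ)
    (hne : ¬ End.HasEigenvalue (A : E →ₗ[ℝ] E) γ) :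
    ∃ U ∈ 𝓝 p, ∀ x y, (∀ n, g^[n] x ∈ U) → (∀ n, g^[n] y ∈ U) →
      ⟪A (x - y), x - y⟫_ℝ - γ * ‖x - y‖ ^ 2 ≤ 0 := by
  obtain ⟨U, hU, hUQ⟩ := exists_nhds_sq_mul_inner_sub_le hg hA hpos (by linarith) hne
  refine ⟨U ∩ Metric.ball p 1, inter_mem hU (Metric.ball_mem_nhds p one_pos),
    fun x y hx hy => ?_⟩
  set Q : E → ℝ := fun z => ⟪A z, z⟫_ℝ - γ * ‖z‖ ^ 2 with hQ
  by_contra! hcon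
  replace hcon : 0 < Q (x - y) := hcon
  have hgrow : ∀ n : ℕ, (γ ^ 2) ^ n * Q (x - y) ≤ Q (g^[n] x - g^[n] y) := by
    intro n
    induction n with
    | zero => simp
    | succ n ih =>
      rw [Function.iterate_succ_apply', Function.iterate_succ_apply']
      refine le_trans ?_ (hUQ _ (hx n).1 _ (hy n).1)
      calc (γ ^ 2) ^ (n + 1) * Q (x - y) = γ ^ 2 * ((γ ^ 2) ^ n * Q (x - y)) := by ring
        _ ≤ _ := by gcongr
  have hbdd : ∀ n : ℕ, Q (g^[n] x - g^[n] y) ≤ ‖A‖ * 2 ^ 2 := by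
    intro n
    set z := g^[n] x - g^[n] y
    have hz : ‖z‖ ≤ 2 := by
      have h1 := dist_triangle_right (g^[n] x) (g^[n] y) p
      have h2 := Metric.mem_ball.1 (hx n).2
      have h3 := Metric.mem_ball.1 (hy n).2
      rw [← dist_eq_norm]
      linarith
    calc Q z ≤ ⟪A z, z⟫_ℝ := by
          have : 0 ≤ γ * ‖z‖ ^ 2 := by positivity
          simp only [hQ]
          linarith
      _ ≤ ‖A z‖ * ‖z‖ := real_inner_le_norm _ _
      _ ≤ ‖A‖ * ‖z‖ * ‖z‖ := by gcongr; exact A.le_opNorm z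
      _ = ‖A‖ * ‖z‖ ^ 2 := by ring
      _ ≤ _ := by gcongr
  obtain ⟨n, hn⟩ := pow_unbounded_of_one_lt (‖A‖ * 2 ^ 2 / Q (x - y))
    (show 1 < γ ^ 2 by nlinarith)
  rw [div_lt_iff₀ hcon] at hn
  linarith [hgrow n, hbdd n]

/-- A set on whose differences the form `⟪A z, z⟫ - γ ‖z‖²` is nonpositive is null if `A` has an
eigenvalue above `γ`: for an eigenvector `v`, the set is a Lipschitz graph over part of the
hyperplane `vᗮ`. -/
theorem hausdorffMeasure_eq_zero_of_inner_sub_nonpos [FiniteDimensional ℝ E] [MeasurableSpace E]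
    [BorelSpace E] {A : E →L[ℝ] E} (hA : (A : E →ₗ[ℝ] E).IsSymmetric) {β γ : ℝ} (hγ : 0 ≤ γ)
    (hβγ : γ < β) (hβ : End.HasEigenvalue (A : E →ₗ[ℝ] E) β) {s : Set E}
    (hs : ∀ x ∈ s, ∀ y ∈ s, ⟪A (x - y), x - y⟫_ℝ - γ * ‖x - y‖ ^ 2 ≤ 0) :
    μH[finrank ℝ E] s = 0 := by
  obtain ⟨v, hv⟩ := hβ.exists_hasEigenvector
  have hv0 : v ≠ 0 := hv.2
  have hAv : A v = β • v := hv.apply_eq_smul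
  set P := (ℝ ∙ v)ᗮ.orthogonalProjectionOnto with hP
  have hδ : 0 < β - γ := sub_pos.2 hβγ
  have hA' : ∀ x y, ⟪A x, y⟫_ℝ = ⟪x, A y⟫_ℝ := fun x y => hA x y
  have key : ∀ z, ⟪A z, z⟫_ℝ - γ * ‖z‖ ^ 2 ≤ 0 →
      ‖z‖ ^ 2 ≤ (1 + (‖A‖ + γ) / (β - γ)) * ‖P z‖ ^ 2 := by
    intro z hz
    obtain ⟨t, ht⟩ := Submodule.mem_span_singleton.1
      ((ℝ ∙ v).orthogonalProjectionOnto z).2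
    set w : E := (P z : E) with hw
    have hzw : z = t • v + w := by
      rw [ht, hw, hP]
      exact ((ℝ ∙ v).starProjection_add_starProjection_orthogonal z).symm
    have hvw : ⟪v, w⟫_ℝ = 0 := Submodule.mem_orthogonal_singleton_iff_inner_right.1 (P z).2
    have hwv : ⟪w, v⟫_ℝ = 0 := by rw [real_inner_comm, hvw]
    have hAwv : ⟪A w, v⟫_ℝ = 0 := by rw [hA', hAv, real_inner_smul_right, hwv, mul_zero]
    have hnorm : ‖z‖ ^ 2 = t ^ 2 * ‖v‖ ^ 2 + ‖w‖ ^ 2 := by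
      rw [hzw, norm_add_sq_real, real_inner_smul_left, hvw, norm_smul, mul_pow,
        Real.norm_eq_abs, sq_abs]
      ring
    have hAzz : ⟪A z, z⟫_ℝ = β * (t ^ 2 * ‖v‖ ^ 2) + ⟪A w, w⟫_ℝ := by
      rw [hzw, map_add, map_smul, hAv]
      simp only [inner_add_left, inner_add_right, real_inner_smul_left, real_inner_smul_right,
        hvw, hAwv, real_inner_self_eq_norm_sq]
      ring
    have hAww : -(‖A‖ * ‖w‖ ^ 2) ≤ ⟪A w, w⟫_ℝ := by
      refine (neg_le_neg ?_).trans (neg_le_of_abs_le (abs_real_inner_le_norm _ _))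
      calc ‖A w‖ * ‖w‖ ≤ ‖A‖ * ‖w‖ * ‖w‖ := by gcongr; exact A.le_opNorm w
        _ = _ := by ring
    have hPz : ‖P z‖ = ‖w‖ := rfl
    have ht2 : t ^ 2 * ‖v‖ ^ 2 ≤ (‖A‖ + γ) / (β - γ) * ‖w‖ ^ 2 := by
      rw [div_mul_eq_mul_div, le_div_iff₀ hδ]
      rw [hAzz, hnorm] at hz
      linarith
    rw [hPz, hnorm]
    linarith
  set C : ℝ := 1 + (‖A‖ + γ) / (β - γ) with hC
  have hC0 : 0 ≤ C := by positivity
  refine hausdorffMeasure_eq_zero_of_antilipschitzOn (h := P) (K := (√C).toNNReal)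
    (Nat.cast_nonneg _) (fun x hx y hy => ?_) ?_
  · rw [Real.coe_toNNReal _ (Real.sqrt_nonneg _), dist_eq_norm, dist_eq_norm, ← map_sub]
    refine (pow_le_pow_iff_left₀ (norm_nonneg _) (by positivity) two_ne_zero).1 ?_
    rw [mul_pow, Real.sq_sqrt hC0]
    exact key _ (hs x hx y hy)
  · refine measure_mono_null (Set.subset_univ _) ?_
    have hlt : finrank ℝ (ℝ ∙ v)ᗮ < finrank ℝ E := by
      have := (ℝ ∙ v).finrank_add_finrank_orthogonal
      rw [finrank_span_singleton hv0] at this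
      omega
    have := hausdorffMeasure_of_dimH_lt (X := (ℝ ∙ v)ᗮ) (s := Set.univ)
      (d := (finrank ℝ E : ℝ≥0)) (by
        rw [Real.dimH_univ_eq_finrank]
        exact_mod_cast hlt)
    simpa using this

/-- The null-set form of the center-stable manifold theorem, for a symmetric nonnegative derivative
with an eigenvalue above `1`: the points whose orbit stays near the fixed point form a null set. -/
theorem exists_nhds_hausdorffMeasure_eq_zero [FiniteDimensional ℝ E] [MeasurableSpace E]
    [BorelSpace E] {g : E → E} {A : E →L[ℝ] E} {p : E}
    (hg : HasStrictFDerivAt g A p) (hA : (A : E →ₗ[ℝ] E).IsSymmetric)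
    (hpos : ∀ z, 0 ≤ ⟪A z, z⟫_ℝ) {β : ℝ} (hβ1 : 1 < β)
    (hβ : End.HasEigenvalue (A : E →ₗ[ℝ] E) β) :
    ∃ U ∈ 𝓝 p, μH[finrank ℝ E] {x | ∀ n, g^[n] x ∈ U} = 0 := by
  have hfin : {μ : ℝ | End.HasEigenvalue (A : E →ₗ[ℝ] E) μ}.Finite := End.finite_hasEigenvalue _
  obtain ⟨γ, ⟨hγ1, hγβ⟩, hγ⟩ := (Set.Ioo_infinite hβ1).exists_notMem_finite hfin
  obtain ⟨U, hU, hUQ⟩ := exists_nhds_inner_sub_nonpos hg hA hpos hγ1 hγ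
  exact ⟨U, hU, hausdorffMeasure_eq_zero_of_inner_sub_nonpos hA (by linarith) hγβ hβ
    fun x hx y hy => hUQ x y hx hy⟩

end Dynamics

/-! ### The Hessian and the gradient step -/

section Gradient

variable {d : ℕ} {f : EuclideanSpace ℝ (Fin d) → ℝ} {x : EuclideanSpace ℝ (Fin d)}

theorem contDiffAt_gradient (hf : ContDiffAt ℝ 2 f x) : ContDiffAt ℝ 1 (gradient f) x := by
  let e : (EuclideanSpace ℝ (Fin d) →L[ℝ] ℝ) ≃ₗᵢ[ℝ] EuclideanSpace ℝ (Fin d) :=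
    (InnerProductSpace.toDual ℝ (EuclideanSpace ℝ (Fin d))).symm
  exact e.contDiff.contDiffAt.comp x (hf.fderiv_right (m := 1) (by norm_num))

theorem hasStrictFDerivAt_gradient (hf : ContDiffAt ℝ 2 f x) :
    HasStrictFDerivAt (gradient f) (hessian f x) x :=
  (contDiffAt_gradient hf).hasStrictFDerivAt one_ne_zero

theorem continuousAt_hessian (hf : ContDiffAt ℝ 2 f x) : ContinuousAt (hessian f) x :=
  ((contDiffAt_gradient hf).fderiv_right (m := 0) (by norm_num)).continuousAt

theorem hessian_isSymmetric (hf : ContDiffAt ℝ 2 f x) :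
    (hessian f x : EuclideanSpace ℝ (Fin d) →ₗ[ℝ] EuclideanSpace ℝ (Fin d)).IsSymmetric := by
  have hD : DifferentiableAt ℝ (fderiv ℝ f) x :=
    (hf.fderiv_right (m := 1) (by norm_num)).differentiableAt one_ne_zero
  have key : ∀ u v, ⟪hessian f x u, v⟫_ℝ = fderiv ℝ (fderiv ℝ f) x u v := by
    intro u v
    have h1 : HasFDerivAt (fun y => ⟪v, gradient f y⟫_ℝ) ((innerSL ℝ v).comp (hessian f x)) x :=
      (innerSL ℝ v).hasFDerivAt.comp x (hasStrictFDerivAt_gradient hf).hasFDerivAt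
    have h2 : HasFDerivAt (fun y => fderiv ℝ f y v)
        ((ContinuousLinearMap.apply ℝ ℝ v).comp (fderiv ℝ (fderiv ℝ f) x)) x :=
      (ContinuousLinearMap.apply ℝ ℝ v).hasFDerivAt.comp x hD.hasFDerivAt
    have h3 : (fun y => ⟪v, gradient f y⟫_ℝ) = fun y => fderiv ℝ f y v := by
      ext y
      rw [real_inner_comm, gradient, InnerProductSpace.toDual_symm_apply]
    rw [h3] at h1
    have h4 := congrArg (fun T => T u) (h1.unique h2)
    rw [real_inner_comm]
    simpa using h4
  intro u v
  have hs := hf.isSymmSndFDerivAt (by simp) u v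
  change ⟪hessian f x u, v⟫_ℝ = ⟪u, hessian f x v⟫_ℝ
  rw [real_inner_comm _ u, key, key, hs]

/-- The Rayleigh quotient of the Hessian is bounded by its largest eigenvalue. -/
theorem inner_hessian_le_of_hessianPosPart_le (hf : ContDiffAt ℝ 2 f x) {L : ℝ}
    (hL : hessianPosPart f x ≤ L) (z : EuclideanSpace ℝ (Fin d)) :
    ⟪hessian f x z, z⟫_ℝ ≤ L * ‖z‖ ^ 2 := by
  rcases eq_or_ne z 0 with rfl | hz
  · simp
  have : Nontrivial (EuclideanSpace ℝ (Fin d)) := ⟨z, 0, hz⟩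
  have hev := (hessian_isSymmetric hf).hasEigenvalue_iSup_of_finiteDimensional
  set H := hessian f x with hH
  have hbdd : BddAbove (Set.range fun x : {x : EuclideanSpace ℝ (Fin d) // x ≠ 0} =>
      RCLike.re ⟪(H : EuclideanSpace ℝ (Fin d) →ₗ[ℝ] EuclideanSpace ℝ (Fin d)) x, x⟫_ℝ
        / ‖(x : EuclideanSpace ℝ (Fin d))‖ ^ 2) := by
    refine ⟨‖H‖, ?_⟩
    rintro _ ⟨⟨y, hy⟩, rfl⟩
    have hy' : 0 < ‖y‖ := norm_pos_iff.2 hy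
    change ⟪H y, y⟫_ℝ / ‖y‖ ^ 2 ≤ ‖H‖
    rw [div_le_iff₀ (by positivity)]
    calc ⟪H y, y⟫_ℝ ≤ ‖H y‖ * ‖y‖ := real_inner_le_norm _ _
      _ ≤ ‖H‖ * ‖y‖ * ‖y‖ := by gcongr; exact H.le_opNorm y
      _ = _ := by ring
  have hle := le_ciSup hbdd ⟨z, hz⟩
  set μ := ⨆ x : {x : EuclideanSpace ℝ (Fin d) // x ≠ 0},
      RCLike.re ⟪(H : EuclideanSpace ℝ (Fin d) →ₗ[ℝ] EuclideanSpace ℝ (Fin d)) x, x⟫_ℝ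
        / ‖(x : EuclideanSpace ℝ (Fin d))‖ ^ 2
  have hfin : {μ : ℝ | IsHessianEigenvalue f x μ}.Finite := End.finite_hasEigenvalue _
  have hμ : μ ≤ L :=
    (le_max_left μ 0).trans <| (le_csSup (hfin.image _).bddAbove ⟨μ, hev, rfl⟩).trans hL
  have hz' : 0 < ‖z‖ := norm_pos_iff.2 hz
  have h1 : ⟪H z, z⟫_ℝ / ‖z‖ ^ 2 ≤ L := le_trans hle hμ
  rwa [div_le_iff₀ (by positivity)] at h1

theorem hasStrictFDerivAt_gradStep (hf : ContDiffAt ℝ 2 f x) (α : ℝ) :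
    HasStrictFDerivAt (gradStep f α)
      (ContinuousLinearMap.id ℝ (EuclideanSpace ℝ (Fin d)) - α • hessian f x) x :=
  (hasStrictFDerivAt_id x).sub ((hasStrictFDerivAt_gradient hf).const_smul α)

/-- Where the Hessian is at most `L`, the gradient step is strongly monotone along convex sets;
hence it is injective with a Lipschitz inverse, whatever the size of the negative eigenvalues. -/
theorem mul_dist_le_dist_gradStep {Ω : Set (EuclideanSpace ℝ (Fin d))} (hΩ : Convex ℝ Ω)
    (hf : ∀ x ∈ Ω, ContDiffAt ℝ 2 f x) {L α : ℝ} (hα : 0 ≤ α)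
    (hL : ∀ x ∈ Ω, ∀ z, ⟪hessian f x z, z⟫_ℝ ≤ L * ‖z‖ ^ 2)
    {y : EuclideanSpace ℝ (Fin d)} (hx : x ∈ Ω) (hy : y ∈ Ω) :
    (1 - α * L) * dist x y ≤ dist (gradStep f α x) (gradStep f α y) := by
  rcases eq_or_ne x y with rfl | hxy
  · simp
  set z := x - y with hz
  have hmem : ∀ t ∈ Set.Icc (0 : ℝ) 1, y + t • z ∈ Ω := fun t ht =>
    hΩ.add_smul_sub_mem hy hx ht
  have hder : ∀ t ∈ Set.Icc (0 : ℝ) 1, HasDerivAt (fun t : ℝ => ⟪z, gradStep f α (y + t • z)⟫_ℝ)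
      ⟪z, z - α • hessian f (y + t • z) z⟫_ℝ t := by
    intro t ht
    have h1 : HasDerivAt (fun t : ℝ => y + t • z) z t := by
      simpa using ((hasDerivAt_id t).smul_const z).const_add y
    have h2 := (hasStrictFDerivAt_gradStep (hf _ (hmem t ht)) α).hasFDerivAt.comp_hasDerivAt t h1
    exact (innerSL ℝ z).hasFDerivAt.comp_hasDerivAt t h2
  obtain ⟨t, ht, hslope⟩ := exists_hasDerivAt_eq_slope
    (fun t : ℝ => ⟪z, gradStep f α (y + t • z)⟫_ℝ) _ one_pos
    (fun t ht => (hder t ht).continuousAt.continuousWithinAt)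
    (fun t ht => hder t (Set.Ioo_subset_Icc_self ht))
  have hyz : y + z = x := by simp [hz]
  simp only [one_smul, zero_smul, add_zero, sub_zero, div_one, hyz, ← inner_sub_right] at hslope
  have hH := hL _ (hmem t (Set.Ioo_subset_Icc_self ht)) z
  rw [inner_sub_right, real_inner_smul_right, real_inner_self_eq_norm_sq,
    real_inner_comm] at hslope
  have h1 : (1 - α * L) * ‖z‖ ^ 2 ≤ ⟪z, gradStep f α x - gradStep f α y⟫_ℝ := by
    rw [← hslope]
    nlinarith [mul_le_mul_of_nonneg_left hH hα]
  have h2 := h1.trans (real_inner_le_norm _ _)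
  have hz0 : 0 < ‖z‖ := norm_pos_iff.2 (sub_ne_zero.2 hxy)
  rw [dist_eq_norm, dist_eq_norm, ← hz]
  refine le_of_mul_le_mul_left ?_ hz0
  linarith

/-- The points whose gradient descent orbit stays near a strict saddle form a null set. Only a
bound on the Hessian at the saddle itself is needed. -/
theorem IsStrictSaddle.exists_nhds_hausdorffMeasure_eq_zero {p : EuclideanSpace ℝ (Fin d)}
    (hp : IsStrictSaddle f p) {L α : ℝ} (hα : 0 < α) (hαL : α * L ≤ 1)
    (hL : ∀ z, ⟪hessian f p z, z⟫_ℝ ≤ L * ‖z‖ ^ 2) :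
    ∃ U ∈ 𝓝 p, μH[d] {x | ∀ n, (gradStep f α)^[n] x ∈ U} = 0 := by
  obtain ⟨hf, -, μ, hμ, hev⟩ := hp
  obtain ⟨v, hv⟩ := End.HasEigenvalue.exists_hasEigenvector hev
  have hHv : hessian f p v = μ • v := hv.apply_eq_smul
  have hsymm := hessian_isSymmetric hf
  have := _root_.exists_nhds_hausdorffMeasure_eq_zero (β := 1 - α * μ)
    (hasStrictFDerivAt_gradStep hf α) (fun u w => ?_) (fun z => ?_) ?_ ?_
  · simpa using this
  · have := hsymm u w
    simp only [ContinuousLinearMap.coe_coe] at this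
    simp [inner_sub_left, inner_sub_right, real_inner_smul_left, real_inner_smul_right, this]
  · simp only [sub_apply, ContinuousLinearMap.id_apply,
      smul_apply, inner_sub_left, real_inner_smul_left,
      real_inner_self_eq_norm_sq]
    nlinarith [mul_le_mul_of_nonneg_left (hL z) hα.le, sq_nonneg ‖z‖]
  · nlinarith [mul_pos hα (neg_pos.2 hμ)]
  · refine End.hasEigenvalue_of_hasEigenvector (x := v) ⟨End.mem_eigenspace_iff.2 ?_, hv.2⟩
    simp [hHv, sub_smul, mul_smul]

end Gradient

/-! ### Convergence to strict saddles -/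

theorem mainTheorem2 (d : ℕ) (f : EuclideanSpace ℝ (Fin d) → ℝ)
    (Ω : Set (EuclideanSpace ℝ (Fin d))) (hΩ : Convex ℝ Ω)
    (hf : ∀ x ∈ Ω, ContDiffAt ℝ 2 f x)
    (α : ℝ) (hinv : Set.MapsTo (gradStep f α) Ω Ω)
    (L : ℝ) (hL : IsLUB (hessianPosPart f '' Ω) L)
    (hα : α * L ∈ Set.Ioo (0 : ℝ) 1) :
    MeasureTheory.volume
      {x ∈ Ω | ∃ p, IsStrictSaddle f p ∧
        Filter.Tendsto (fun n : ℕ => (gradStep f α)^[n] x) Filter.atTop (nhds p)} = 0 := by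
  set g := gradStep f α with hg
  have hH : ∀ x ∈ Ω, ∀ z, ⟪hessian f x z, z⟫_ℝ ≤ L * ‖z‖ ^ 2 := fun x hx z =>
    inner_hessian_le_of_hessianPosPart_le (hf x hx) (hL.1 ⟨x, hx, rfl⟩) z
  -- `L` is a supremum of nonnegative numbers, so `0 < α * L` forces `0 < α`.
  have hα0 : 0 < α := by
    obtain ⟨_, x, hx, rfl⟩ := hL.nonempty
    have h0 : 0 ≤ hessianPosPart f x := by
      refine Real.sSup_nonneg ?_
      rintro _ ⟨μ, -, rfl⟩
      exact le_max_right _ _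
    exact pos_of_mul_pos_left hα.1 (h0.trans (hL.1 ⟨x, hx, rfl⟩))
  set c := 1 - α * L with hc
  have hc0 : 0 < c := sub_pos.2 hα.2
  have hiter : ∀ n x, x ∈ Ω → g^[n] x ∈ Ω := fun n x hx => hinv.iterate n hx
  have hanti : ∀ n : ℕ, ∀ x ∈ Ω, ∀ y ∈ Ω, c ^ n * dist x y ≤ dist (g^[n] x) (g^[n] y) := by
    intro n x hx y hy
    induction n with
    | zero => simp
    | succ n ih =>
      rw [Function.iterate_succ_apply', Function.iterate_succ_apply']
      refine le_trans ?_
        (mul_dist_le_dist_gradStep hΩ hf hα0.le hH (hiter n x hx) (hiter n y hy))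
      rw [pow_succ', mul_assoc]
      gcongr
  -- A saddle that attracts a point of `Ω` may lie on the boundary of `Ω`, outside `Ω`; the bound
  -- on the Hessian extends to it by continuity.
  set S := {p | IsStrictSaddle f p ∧ p ∈ closure Ω} with hS
  have hloc : ∀ p ∈ S, ∃ U ∈ 𝓝 p, μH[d] {x | ∀ n, g^[n] x ∈ U} = 0 := by
    rintro p ⟨hp, hpΩ⟩
    refine hp.exists_nhds_hausdorffMeasure_eq_zero hα0 hα.2.le fun z => ?_
    have : (𝓝[Ω] p).NeBot := mem_closure_iff_nhdsWithin_neBot.1 hpΩ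
    have hcont : Tendsto (fun x => ⟪hessian f x z, z⟫_ℝ) (𝓝[Ω] p) (𝓝 ⟪hessian f p z, z⟫_ℝ) :=
      (((continuousAt_hessian hp.1).clm_apply continuousAt_const).inner
        (𝕜 := ℝ) continuousAt_const).mono_left nhdsWithin_le_nhds
    exact le_of_tendsto hcont (eventually_mem_nhdsWithin.mono fun x hx => hH x hx z)
  choose! U hU hU0 using hloc
  obtain ⟨T, hTS, hTc, hTU⟩ := TopologicalSpace.countable_cover_nhdsWithin
    (f := fun p => interior (U p)) (s := S)
    (fun p hp => mem_nhdsWithin_of_mem_nhds (interior_mem_nhds.2 (hU p hp)))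
  have hnull : μH[d] (⋃ p ∈ T, ⋃ n : ℕ, {x ∈ Ω | ∀ m, g^[m] (g^[n] x) ∈ U p}) = 0 := by
    refine (measure_biUnion_null_iff hTc).2 fun p hp => measure_iUnion_null fun n => ?_
    refine hausdorffMeasure_eq_zero_of_antilipschitzOn (h := g^[n])
      (K := ((c ^ n)⁻¹).toNNReal) (Nat.cast_nonneg _) (fun x hx y hy => ?_)
      (measure_mono_null ?_ (hU0 p (hTS hp)))
    · rw [Real.coe_toNNReal _ (by positivity), ← div_eq_inv_mul, le_div_iff₀' (by positivity)]
      exact hanti n x hx.1 y hy.1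
    · rintro _ ⟨x, hx, rfl⟩
      exact hx.2
  have hac : (volume : Measure (EuclideanSpace ℝ (Fin d))) ≪ μH[d] := by
    have := Measure.absolutelyContinuous_isAddHaarMeasure
      (volume : Measure (EuclideanSpace ℝ (Fin d)))
      (μH[finrank ℝ (EuclideanSpace ℝ (Fin d))])
    simpa using this
  refine hac (measure_mono_null ?_ hnull)
  rintro x ⟨hx, p, hp, hlim⟩
  have hpS : p ∈ S :=
    ⟨hp, mem_closure_of_tendsto hlim (Eventually.of_forall fun n => hiter n x hx)⟩
  obtain ⟨q, hq, hpq⟩ := Set.mem_iUnion₂.1 (hTU hpS)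
  obtain ⟨n, hn⟩ := eventually_atTop.1 (hlim.eventually_mem (mem_interior_iff_mem_nhds.1 hpq))
  refine Set.mem_iUnion₂.2 ⟨q, hq, Set.mem_iUnion.2 ⟨n, hx, fun m => ?_⟩⟩
  rw [← Function.iterate_add_apply]
  exact hn _ (Nat.le_add_left n m)
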